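/- Let $d\ge 1$ and $N,M\ge 0$ be integers. For bit strings $x,y\in\{0,1\}^N$ write $x\cdot y=\sum_n x_ny_n$, $w_x=x\cdot x$, and $\bar x$ for the complement of $x$. Consider $M$ input spins (IN) and $N$ output spins, each with state space $\mathbb C^d$. Let $\{|\phi_i\rangle\}$ be any orthonormal basis of the symmetric subspace of $(\mathbb C^d)^{\otimes M}$ (the vectors invariant under all permutations of the $M$ tensor factors), and let $|\Phi\rangle$ be any unit vector of the symmetric subspace of $(\mathbb C^d)^{\otimes (N-M)}$. For $x\in\{0,1\}^N$ with $w_x=M$ define the special state $$ |\psi_x\rangle=|B_x^{(M)}\rangle|\Phi\rangle_{\bar x},\qquad |B_x^{(M)}\rangle=\frac{1}{\sqrt{\binom{M+d-1}{M}}}\sum_i|\phi_i\rangle_{\mathrm{IN}}|\phi_i\rangle_x , $$ where the subscript $x$ (respectively $\bar x$) means that the state is placed on the output spins $n$ with $x_n=1$ (respectively $x_n=0$). For $y\in\{0,1\}^N$ let $G_y^{(M)}$ be the matrix, with rows and columns indexed by the bit strings $x,z\in\{0,1\}^N$ of weight $M$, whose entries are $$ (G_y^{(M)})_{x,z}=\binom{M+d-1-x\cdot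 z+w_{\bar x\cap\bar z\cap y}}{d-1}^{-1}, $$ where $w_{\bar x\cap\bar z\cap y}$ is the number of $n$ with $x_n=z_n=0$ and $y_n=1$. Then for all $x,y\in\{0,1\}^N$ with $w_x=w_y=M$, $$ \langle\psi_x|\psi_y\rangle=\frac{1}{\binom{M-x\cdot y+d-1}{d-1}} , $$ and hence $G_0^{(M)}$ (the case of the zero string) is the Gram matrix of the family $(|\psi_x\rangle)_{w_x=M}$. -/

import Mathlib

noncomputable section

/-! ### Bit strings -/

/-- The Hamming weight of a bit string, i.e. the number of its 1 entries. -/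
def bitWeight {N : ℕ} (x : Fin N → Bool) : ℕ := ∑ n, (x n).toNat

/-- The dot product of two bit strings, as a natural number. -/
def bitDot {N : ℕ} (x y : Fin N → Bool) : ℕ := ∑ n, (x n).toNat * (y n).toNat

/-- The bit strings of length `N` and weight `M`. -/
abbrev BitString (N M : ℕ) : Type := {x : Fin N → Bool // bitWeight x = M}

/-- The sites `n` with `x n = 1`. -/
abbrev oneSites {N : ℕ} (x : Fin N → Bool) : Type := {n : Fin N // x n = true}

/-- The sites `n` with `x n = 0`, that is, the sites of the complement of `x`. -/
abbrev zeroSites {N : ℕ} (x : Fin N → Bool) : Type := {n : Fin N // ¬ x n = true}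

theorem card_oneSites {N M : ℕ} (x : BitString N M) : Fintype.card (oneSites x.1) = M := by
  rw [Fintype.card_subtype, Finset.card_filter]
  refine Eq.trans ?_ x.2
  refine Finset.sum_congr rfl fun n _ => ?_
  cases x.1 n <;> simp

theorem card_zeroSites {N M : ℕ} (x : BitString N M) :
    Fintype.card (zeroSites x.1) = N - M := by
  rw [Fintype.card_subtype_compl, Fintype.card_fin, card_oneSites]

/-- The increasing enumeration of the sites of `x`. -/
def enumOnes {N M : ℕ} (x : BitString N M) : Fin M ≃ oneSites x.1 :=
  (Fintype.orderIsoFinOfCardEq (oneSites x.1) (card_oneSites x)).toEquiv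

/-- The increasing enumeration of the sites of the complement of `x`. -/
def enumZeros {N M : ℕ} (x : BitString N M) : Fin (N - M) ≃ zeroSites x.1 :=
  (Fintype.orderIsoFinOfCardEq (zeroSites x.1) (card_zeroSites x)).toEquiv

/-! ### Systems of `d`-dimensional spins -/

/-- The Hilbert space `(ℂ^d)^{⊗ ι}` of `d`-dimensional spins on a finite set `ι` of sites, in its
computational basis: a vector is the family of its amplitudes on the basis states `|s⟩`,
`s : ι → Fin d`. -/
abbrev Spins (d : ℕ) (ι : Type*) [Fintype ι] [DecidableEq ι] : Type _ :=
  EuclideanSpace ℂ (ι → Fin d)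

/-- Transport of a state along a bijection `e` of sites: the spin on site `i` is put on `e i`. -/
def relabel {d : ℕ} {ι κ : Type*} [Fintype ι] [DecidableEq ι] [Fintype κ] [DecidableEq κ]
    (e : ι ≃ κ) (u : Spins d ι) : Spins d κ :=
  WithLp.toLp 2 fun s => u (s ∘ e)

/-- The tensor product `|u⟩|v⟩` of states of two systems of spins. -/
def tensorState {d : ℕ} {ι κ : Type*} [Fintype ι] [DecidableEq ι] [Fintype κ] [DecidableEq κ]
    (u : Spins d ι) (v : Spins d κ) : Spins d (ι ⊕ κ) :=
  WithLp.toLp 2 fun s => u (s ∘ Sum.inl) * v (s ∘ Sum.inr)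

/-- The symmetric subspace: the states invariant under all permutations of the sites. -/
def symSubspace (d : ℕ) (ι : Type*) [Fintype ι] [DecidableEq ι] : Submodule ℂ (Spins d ι) where
  carrier := {u | ∀ π : Equiv.Perm ι, relabel π u = u}
  add_mem' := by
    intro a b ha hb π
    nth_rewrite 2 [← ha π, ← hb π]
    rfl
  zero_mem' := fun _ => rfl
  smul_mem' := by
    intro c a ha π
    nth_rewrite 2 [← ha π]
    rfl

/-- Placing a symmetric state on a set of sites does not depend on the enumeration of the
sites. -/
theorem relabel_eq_of_mem_symSubspace {d : ℕ} {ι κ : Type*} [Fintype ι] [DecidableEq ι]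
    [Fintype κ] [DecidableEq κ] (e f : ι ≃ κ) {u : Spins d ι} (hu : u ∈ symSubspace d ι) :
    relabel e u = relabel f u := by
  have h := hu (e.trans f.symm)
  nth_rewrite 2 [← h]
  ext s
  simp [relabel, Function.comp_def]

/-- The Bell state `|B_x^{(M)}⟩ = C(M+d-1, M)^{-1/2} ∑_i |φ_i^{IN}⟩|φ_i^x⟩` of the `M` input spins
and the `M` output spins on the sites of `x`, for an orthonormal basis `φ` of the symmetric
subspace of `M` spins. -/
def bellState {d N M : ℕ} {κ : Type*} [Fintype κ]
    (φ : OrthonormalBasis κ ℂ (symSubspace d (Fin M))) (x : BitString N M) :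
    Spins d (Fin M ⊕ oneSites x.1) :=
  (((Real.sqrt ((M + d - 1).choose M) : ℝ) : ℂ)⁻¹) •
    ∑ i, tensorState (φ i : Spins d (Fin M)) (relabel (enumOnes x) (φ i : Spins d (Fin M)))

/-- Input spins, sites of `x` and sites of the complement of `x`, taken together, are the input
spins and all `N` output spins. -/
def siteSplit {N M : ℕ} (x : BitString N M) :
    (Fin M ⊕ oneSites x.1) ⊕ zeroSites x.1 ≃ Fin M ⊕ Fin N :=
  (Equiv.sumAssoc _ _ _).trans
    (Equiv.sumCongr (Equiv.refl _) (Equiv.sumCompl fun n => x.1 n = true))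

/-- The special state `|ψ_x⟩ = |B_x^{(M)}⟩|Φ⟩_{x̄}` of the `M` input and `N` output spins. -/
def specialState {d N M : ℕ} {κ : Type*} [Fintype κ]
    (φ : OrthonormalBasis κ ℂ (symSubspace d (Fin M))) (Φ : Spins d (Fin (N - M)))
    (x : BitString N M) : Spins d (Fin M ⊕ Fin N) :=
  relabel (siteSplit x) (tensorState (bellState φ x) (relabel (enumZeros x) Φ))

/-! ### The matrices `G_y^{(M)}` -/

/-- The matrix `G_y^{(M)}` on the bit strings of weight `M`, with entries
`1 / C(M + d - 1 - x·z + w(x̄ ∩ z̄ ∩ y), d - 1)`. -/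
def matrixG (d : ℕ) {N : ℕ} (M : ℕ) (y : Fin N → Bool) :
    Matrix (BitString N M) (BitString N M) ℝ :=
  Matrix.of fun x z =>
    1 / ((M + d - 1 - bitDot x.1 z.1 + bitWeight fun n => !x.1 n && !z.1 n && y n).choose
      (d - 1) : ℝ)

end

/-! Orthonormality of `φ` sums out the input spins of an overlap. What remains is C(M+d-1, M)⁻¹
times a sum, over configurations of the output spins, of an entry of the projection onto the
symmetric subspace times values of Φ. That projection is the average of the M! permutations, so its
entries are `matchCount b a / M!`, whatever basis is chosen (`sum_orthonormalBasis_symSubspace`).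
The sites common to x and y carry the same values in b and a. Tracing out one site of the sum of all
permutations of m + 1 sites gives m + d times that sum on m sites (`sum_matchCount_option`), so k =
x·y common sites give a rising factorial. The bijections left over on the t = M - x·y other sites
are absorbed by the symmetry of Φ, each contributing ‖Φ‖² = 1 (`sum_matchCount_mul_symmetric`). The
factorials then collapse to the stated binomial. -/

open scoped ComplexConjugate

/-! ### Counting matching bijections, and partial traces -/

/-- The number of bijections of sites that carry the configuration `a` to the configuration `b`. -/
def matchCount {ι κ α : Type*} [Fintype ι] [DecidableEq ι] [Fintype κ] [DecidableEq κ]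
    [DecidableEq α] (b : ι → α) (a : κ → α) : ℕ :=
  ∑ e : ι ≃ κ, if b = a ∘ e then 1 else 0

/-- The permutation sends `none` to `some i` and the σ-preimage of i to `none`, elsewhere acting as
σ. Once c = a i, that detour through `none` reads the value that σ alone would read. -/
theorem comp_decomposeOption_symm_eq_iff {ι α : Type*} [DecidableEq ι] (b a : ι → α) (c : α) (i : ι)
    (σ : Equiv.Perm ι) :
    ((fun o : Option ι => o.elim c b) =
      (fun o : Option ι => o.elim c a) ∘ Equiv.Perm.decomposeOption.symm (some i, σ)) ↔
      c = a i ∧ b = a ∘ σ := by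
  have key : ∀ j, Equiv.Perm.decomposeOption.symm (some i, σ) (some j) =
      if σ j = i then none else some (σ j) := by
    intro j
    simp [Equiv.Perm.decomposeOption, Equiv.swap_apply_def]
  constructor
  · intro h
    have h0 : c = a i := by
      have := congrFun h none
      simpa [Equiv.Perm.decomposeOption] using this
    refine ⟨h0, funext fun j => ?_⟩
    have := congrFun h (some j)
    simp only [Function.comp, key] at this
    by_cases hj : σ j = i
    · simpa [hj, h0] using this
    · simpa [hj] using this
  · rintro ⟨rfl, rfl⟩
    funext o
    cases o with
    | none => simp [Equiv.Perm.decomposeOption]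
    | some j =>
      simp only [Function.comp, key]
      by_cases hj : σ j = i <;> simp [hj]

theorem comp_decomposeOption_symm_none_eq_iff {ι α : Type*} [DecidableEq ι] (b a : ι → α) (c : α) (σ : Equiv.Perm ι) :
    ((fun o : Option ι => o.elim c b) =
      (fun o : Option ι => o.elim c a) ∘ Equiv.Perm.decomposeOption.symm (none, σ)) ↔
      b = a ∘ σ := by
  constructor
  · intro h
    funext j
    simpa [Equiv.Perm.decomposeOption] using congrFun h (some j)
  · rintro rfl
    funext o
    cases o <;> simp [Equiv.Perm.decomposeOption]

section MatchCount

variable {ι κ ι' κ' α : Type*} [Fintype ι] [DecidableEq ι] [Fintype κ] [DecidableEq κ]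
  [Fintype ι'] [DecidableEq ι'] [Fintype κ'] [DecidableEq κ'] [DecidableEq α]

theorem matchCount_comp_left (b : ι → α) (a : κ → α) (σ : ι' ≃ ι) :
    matchCount (b ∘ σ) a = matchCount b a := by
  refine Fintype.sum_equiv (σ.equivCongr (Equiv.refl κ)) _ _ fun e => ?_
  have h : b ∘ σ = a ∘ e ↔ b = a ∘ (σ.equivCongr (Equiv.refl κ) e) := by
    rw [← Equiv.eq_comp_symm]
    rfl
  simp only [h]

theorem matchCount_comp_right (b : ι → α) (a : κ → α) (τ : κ' ≃ κ) :
    matchCount b (a ∘ τ) = matchCount b a := by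
  refine Fintype.sum_equiv ((Equiv.refl ι).equivCongr τ) _ _ fun e => ?_
  rfl

/-- The partial trace over one site. -/
theorem sum_matchCount_option [Fintype α] (b a : ι → α) :
    ∑ c, matchCount (fun o : Option ι => o.elim c b) (fun o : Option ι => o.elim c a) =
      (Fintype.card ι + Fintype.card α) * matchCount b a := by
  -- Split by the image of `none`. If it is fixed, c is free, which gives `card α` terms after
  -- summation; if it goes to i, then c is forced to be a i.
  have h : ∀ c, matchCount (fun o : Option ι => o.elim c b) (fun o : Option ι => o.elim c a) =
      matchCount b a + ∑ i, ∑ σ : Equiv.Perm ι, if c = a i ∧ b = a ∘ σ then 1 else 0 := by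
    intro c
    rw [matchCount, ← Equiv.Perm.decomposeOption.symm.sum_comp, Fintype.sum_prod_type,
      Fintype.sum_option]
    simp only [comp_decomposeOption_symm_eq_iff, comp_decomposeOption_symm_none_eq_iff]
    rfl
  simp only [h, Finset.sum_add_distrib, Finset.sum_const, Finset.card_univ, smul_eq_mul]
  rw [Finset.sum_comm]
  have h2 : ∀ i, ∑ c, ∑ σ : Equiv.Perm ι, (if c = a i ∧ b = a ∘ σ then 1 else 0) =
      matchCount b a := by
    intro i
    rw [Finset.sum_comm]
    refine Finset.sum_congr rfl fun σ _ => ?_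
    by_cases hb : b = a ∘ σ <;> simp [hb]
  simp only [h2, Finset.sum_const, Finset.card_univ, smul_eq_mul]
  ring

/-- The partial trace over a set of sites. -/
theorem sum_matchCount_sumElim_fin [Fintype α] (b a : ι → α) (k : ℕ) :
    ∑ c : Fin k → α, matchCount (Sum.elim c b) (Sum.elim c a) =
      (Fintype.card ι + Fintype.card α).ascFactorial k * matchCount b a := by
  induction k with
  | zero =>
    simp only [Fintype.sum_unique, Nat.ascFactorial_zero, one_mul]
    rw [← matchCount_comp_left (Sum.elim default b) _ (Equiv.emptySum (Fin 0) ι).symm,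
      ← matchCount_comp_right _ (Sum.elim default a) (Equiv.emptySum (Fin 0) ι).symm]
    rfl
  | succ k ih =>
    -- Site 0 of `Fin (k + 1)` plays the role of `none`.
    let e : Option (Fin k ⊕ ι) ≃ Fin (k + 1) ⊕ ι :=
      (((Equiv.sumCongr (finSuccEquiv k) (Equiv.refl ι)).trans
        ((Equiv.sumCongr (Equiv.optionEquivSumPUnit.{0} (Fin k)) (Equiv.refl ι)).trans
        ((Equiv.sumCongr (Equiv.sumComm _ _) (Equiv.refl ι)).trans
        ((Equiv.sumAssoc _ _ _).trans (Equiv.sumComm _ _))))).trans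
        (Equiv.optionEquivSumPUnit.{0} (Fin k ⊕ ι)).symm).symm
    have he : ∀ (x : α) (c : Fin k → α) (f : ι → α),
        (Sum.elim (Fin.cons x c : Fin (k + 1) → α) f) ∘ e =
          fun o : Option (Fin k ⊕ ι) => o.elim x (Sum.elim c f) := by
      intro x c f
      funext o
      rcases o with _ | (j | j) <;> simp [e]
    rw [← (Fin.consEquiv fun _ => α).sum_comp, Fintype.sum_prod_type, Finset.sum_comm]
    have h : ∀ (x : α) (c : Fin k → α),
        matchCount (Sum.elim (Fin.consEquiv (fun _ => α) (x, c)) b)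
          (Sum.elim (Fin.consEquiv (fun _ => α) (x, c)) a) =
        matchCount (fun o : Option (Fin k ⊕ ι) => o.elim x (Sum.elim c b))
          (fun o : Option (Fin k ⊕ ι) => o.elim x (Sum.elim c a)) := by
      intro x c
      rw [← he, ← he, matchCount_comp_left, matchCount_comp_right]
      rfl
    simp only [h, sum_matchCount_option, ← Finset.mul_sum, ih]
    rw [Nat.ascFactorial_succ, Fintype.card_sum, Fintype.card_fin]
    ring

theorem sum_matchCount_sumElim {S X Y : Type*} [Fintype S] [DecidableEq S] [Fintype X]
    [DecidableEq X] [Fintype Y] [DecidableEq Y] [Fintype α] (τ : Y ≃ X) (b : Y → α) (a : X → α) :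
    ∑ c : S → α, matchCount (Sum.elim c b) (Sum.elim c a) =
      (Fintype.card X + Fintype.card α).ascFactorial (Fintype.card S) * matchCount b a := by
  rw [← matchCount_comp_right b a τ, ← Fintype.card_congr τ, ← sum_matchCount_sumElim_fin]
  let f := Fintype.equivFin S
  refine Fintype.sum_equiv (f.arrowCongr (Equiv.refl α)) _ _ fun c => ?_
  rw [← matchCount_comp_left (Sum.elim c b) _ (Equiv.sumCongr f.symm (Equiv.refl Y)),
    ← matchCount_comp_right _ (Sum.elim c a) (Equiv.sumCongr f.symm τ)]
  congr 1 <;> funext s <;> rcases s with s | s <;> rfl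

end MatchCount

/-! ### Symmetric states and the projection onto them -/

section Spins

variable {d : ℕ} {ι κ : Type*} [Fintype ι] [DecidableEq ι] [Fintype κ] [DecidableEq κ]

theorem apply_comp_eq_of_mem_symSubspace {u : Spins d ι} (hu : u ∈ symSubspace d ι)
    (e f : ι ≃ κ) (s : κ → Fin d) : u (s ∘ e) = u (s ∘ f) :=
  congrArg (fun v : Spins d κ => v s) (relabel_eq_of_mem_symSubspace e f hu)

/-- The matrix entries of the projection onto the symmetric subspace. -/
theorem sum_orthonormalBasis_symSubspace {μ : Type*} [Fintype μ]
    (φ : OrthonormalBasis μ ℂ (symSubspace d ι)) (b a : ι → Fin d) :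
    ∑ i, conj ((φ i : Spins d ι) a) * (φ i : Spins d ι) b =
      (matchCount b a : ℂ) / (Fintype.card ι).factorial := by
  -- The claimed column a of the projection, itself a symmetric vector. Expanding it in `φ` gives
  -- the formula, since its coefficients are the conjugates of φ_i(a): averaging over permutations
  -- fixes φ_i.
  let v : symSubspace d ι :=
    ⟨WithLp.toLp 2 fun b => (matchCount b a : ℂ) / (Fintype.card ι).factorial, fun π => by
      ext s
      simp [relabel, matchCount_comp_left]⟩
  have hv : ∀ i, inner ℂ (φ i) v = conj ((φ i : Spins d ι) a) := by
    intro i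
    have h1 : ∀ e : Equiv.Perm ι, (φ i : Spins d ι) (a ∘ e) = (φ i : Spins d ι) a := fun e =>
      apply_comp_eq_of_mem_symSubspace (φ i).2 e (Equiv.refl ι) a
    have h0 : ((Fintype.card ι).factorial : ℂ) ≠ 0 := by exact_mod_cast Nat.factorial_ne_zero _
    calc inner ℂ (φ i) v
        = ∑ s, (matchCount s a : ℂ) / (Fintype.card ι).factorial *
            conj ((φ i : Spins d ι) s) := by
          rw [Submodule.coe_inner, PiLp.inner_apply]
          rfl
      _ = ∑ e : Equiv.Perm ι, conj ((φ i : Spins d ι) (a ∘ e)) / (Fintype.card ι).factorial := by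
          simp only [matchCount, Nat.cast_sum, Finset.sum_div, Finset.sum_mul]
          rw [Finset.sum_comm]
          refine Finset.sum_congr rfl fun e _ => ?_
          rw [Finset.sum_eq_single (a ∘ e)]
          · simp [div_eq_inv_mul]
          · intro s _ hs
            simp [hs]
          · simp
      _ = _ := by
          simp only [h1, Finset.sum_const, Finset.card_univ, Fintype.card_perm, nsmul_eq_mul]
          field_simp
  have h := congrArg (fun w : symSubspace d ι => (w : Spins d ι) b) (φ.sum_repr' v)
  simp only [hv] at h
  simpa [v] using h

theorem sum_conj_mul_eq_one {u : Spins d ι} (hu : ‖u‖ = 1) (e : ι ≃ κ) :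
    ∑ s : κ → Fin d, conj (u (s ∘ e)) * u (s ∘ e) = 1 := by
  have h : inner ℂ u u = (1 : ℂ) := by rw [inner_self_eq_norm_sq_to_K, hu]; simp
  rw [← h, PiLp.inner_apply]
  refine Fintype.sum_equiv (e.symm.arrowCongr (Equiv.refl _)) _ _ fun s => ?_
  simp only [RCLike.inner_apply]
  rw [mul_comm]
  rfl

/-- Each bijection e forces b = a ∘ e, and symmetry of Φ removes e, leaving ⟨Φ|Φ⟩ = 1. There are
|X|! bijections. -/
theorem sum_matchCount_mul_symmetric {n : ℕ} {X Y R : Type*} [Fintype X] [DecidableEq X]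
    [Fintype Y] [DecidableEq Y] [Fintype R] [DecidableEq R] {Φ : Spins d (Fin n)}
    (hΦ : Φ ∈ symSubspace d (Fin n)) (hΦ1 : ‖Φ‖ = 1) (τ : Y ≃ X)
    (h : Fin n ≃ Y ⊕ R) (h' : Fin n ≃ X ⊕ R) :
    ∑ a : X → Fin d, ∑ b : Y → Fin d, ∑ r : R → Fin d, (matchCount b a : ℂ) *
      (conj (Φ (Sum.elim b r ∘ h)) * Φ (Sum.elim a r ∘ h')) = (Fintype.card X).factorial := by
  have key : ∀ e : Y ≃ X, ∑ a : X → Fin d, ∑ b : Y → Fin d, ∑ r : R → Fin d,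
      (if b = a ∘ e then (1 : ℂ) else 0) *
        (conj (Φ (Sum.elim b r ∘ h)) * Φ (Sum.elim a r ∘ h')) = 1 := by
    intro e
    refine Eq.trans ?_ (sum_conj_mul_eq_one hΦ1 h')
    rw [← (Equiv.sumArrowEquivProdArrow X R (Fin d)).symm.sum_comp, Fintype.sum_prod_type]
    refine Finset.sum_congr rfl fun a _ => ?_
    rw [Finset.sum_eq_single (a ∘ e)]
    · refine Finset.sum_congr rfl fun r _ => ?_
      have h1 : Sum.elim (a ∘ e) r ∘ h =
          Sum.elim a r ∘ (h.trans (Equiv.sumCongr e (Equiv.refl R))) := by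
        funext j
        simp only [Function.comp, Equiv.trans_apply]
        cases h j <;> rfl
      rw [h1, apply_comp_eq_of_mem_symSubspace hΦ _ h']
      simp
      rfl
    · intro b _ hb
      simp [hb]
    · simp
  calc _ = ∑ e : Y ≃ X, ∑ a : X → Fin d, ∑ b : Y → Fin d, ∑ r : R → Fin d,
      (if b = a ∘ e then (1 : ℂ) else 0) *
        (conj (Φ (Sum.elim b r ∘ h)) * Φ (Sum.elim a r ∘ h')) := by
        rw [Finset.sum_comm (s := (Finset.univ : Finset (Y ≃ X)))]
        refine Finset.sum_congr rfl fun a _ => ?_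
        rw [Finset.sum_comm (s := (Finset.univ : Finset (Y ≃ X)))]
        refine Finset.sum_congr rfl fun b _ => ?_
        rw [Finset.sum_comm (s := (Finset.univ : Finset (Y ≃ X)))]
        refine Finset.sum_congr rfl fun r _ => ?_
        rw [matchCount, Nat.cast_sum, Finset.sum_mul]
        simp
    _ = _ := by
        simp only [key, Finset.sum_const, Finset.card_univ, Fintype.card_equiv τ,
          Fintype.card_congr τ, nsmul_eq_mul, mul_one]

/-- The overlap of two placements of the basis states and of a symmetric state that share the
sites `S` and `R`. -/
theorem sum_overlap_placements {M n : ℕ} {S X Y R μ : Type*} [Fintype S] [DecidableEq S]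
    [Fintype X] [DecidableEq X] [Fintype Y] [DecidableEq Y] [Fintype R] [DecidableEq R]
    [Fintype μ] (φ : OrthonormalBasis μ ℂ (symSubspace d (Fin M))) {Φ : Spins d (Fin n)}
    (hΦ : Φ ∈ symSubspace d (Fin n)) (hΦ1 : ‖Φ‖ = 1) (τ : Y ≃ X)
    (f : Fin M ≃ S ⊕ X) (f' : Fin M ≃ S ⊕ Y) (h : Fin n ≃ Y ⊕ R) (h' : Fin n ≃ X ⊕ R) :
    ∑ c : S → Fin d, ∑ a : X → Fin d, ∑ b : Y → Fin d, ∑ r : R → Fin d,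
      (∑ i, conj ((φ i : Spins d (Fin M)) (Sum.elim c a ∘ f)) *
        (φ i : Spins d (Fin M)) (Sum.elim c b ∘ f')) *
      (conj (Φ (Sum.elim b r ∘ h)) * Φ (Sum.elim a r ∘ h')) =
    (Fintype.card X + d).ascFactorial (Fintype.card S) * (Fintype.card X).factorial /
      M.factorial := by
  simp only [sum_orthonormalBasis_symSubspace, matchCount_comp_left, matchCount_comp_right,
    Fintype.card_fin]
  rw [← sum_matchCount_mul_symmetric hΦ hΦ1 τ h h', Finset.mul_sum, Finset.sum_div,
    Finset.sum_comm]
  refine Finset.sum_congr rfl fun a _ => ?_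
  rw [Finset.sum_comm, Finset.mul_sum, Finset.sum_div]
  refine Finset.sum_congr rfl fun b _ => ?_
  rw [Finset.sum_comm, Finset.mul_sum, Finset.sum_div]
  refine Finset.sum_congr rfl fun r _ => ?_
  rw [← Finset.sum_mul, ← Finset.sum_div, ← Nat.cast_sum, sum_matchCount_sumElim τ,
    Fintype.card_fin]
  push_cast
  ring

end Spins

/-! ### Overlaps of the special states -/

theorem specialState_apply {d N M : ℕ} {κ : Type*} [Fintype κ]
    (φ : OrthonormalBasis κ ℂ (symSubspace d (Fin M))) (Φ : Spins d (Fin (N - M)))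
    (x : BitString N M) (p : Fin M → Fin d) (s : Fin N → Fin d) :
    specialState φ Φ x (Sum.elim p s) =
      (((Real.sqrt ((M + d - 1).choose M) : ℝ) : ℂ)⁻¹) *
        (∑ i, (φ i : Spins d (Fin M)) p *
          (φ i : Spins d (Fin M)) (s ∘ Subtype.val ∘ enumOnes x)) *
        Φ (s ∘ Subtype.val ∘ enumZeros x) := by
  simp only [specialState, relabel, tensorState, bellState, PiLp.smul_apply, smul_eq_mul,
    WithLp.ofLp_sum, Finset.sum_apply]
  rfl

theorem inner_specialState {d N M : ℕ} {κ : Type*} [Fintype κ]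
    (φ : OrthonormalBasis κ ℂ (symSubspace d (Fin M))) (Φ : Spins d (Fin (N - M)))
    (x y : BitString N M) :
    inner ℂ (specialState φ Φ x) (specialState φ Φ y) =
      ((M + d - 1).choose M : ℂ)⁻¹ * ∑ s : Fin N → Fin d,
        (∑ i, conj ((φ i : Spins d (Fin M)) (s ∘ Subtype.val ∘ enumOnes x)) *
          (φ i : Spins d (Fin M)) (s ∘ Subtype.val ∘ enumOnes y)) *
        (conj (Φ (s ∘ Subtype.val ∘ enumZeros x)) * Φ (s ∘ Subtype.val ∘ enumZeros y)) := by
  classical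
  have hφ : ∀ i j, ∑ p, conj ((φ i : Spins d (Fin M)) p) * (φ j : Spins d (Fin M)) p =
      if i = j then 1 else 0 := by
    intro i j
    rw [← orthonormal_iff_ite.mp φ.orthonormal i j, Submodule.coe_inner, PiLp.inner_apply]
    refine Finset.sum_congr rfl fun p _ => ?_
    rw [RCLike.inner_apply, mul_comm]
  have hsq : (((Real.sqrt ((M + d - 1).choose M) : ℝ) : ℂ)⁻¹) *
      (((Real.sqrt ((M + d - 1).choose M) : ℝ) : ℂ)⁻¹) = ((M + d - 1).choose M : ℂ)⁻¹ := by
    rw [← mul_inv, ← Complex.ofReal_mul, Real.mul_self_sqrt (Nat.cast_nonneg _)]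
    simp
  -- Tracing out the input spins keeps only the diagonal i = j.
  have hB : ∀ A B : κ → ℂ, ∑ p, (∑ i, conj ((φ i : Spins d (Fin M)) p) * A i) *
      (∑ j, (φ j : Spins d (Fin M)) p * B j) = ∑ i, A i * B i := by
    intro A B
    calc _ = ∑ i, ∑ j, (∑ p, conj ((φ i : Spins d (Fin M)) p) * (φ j : Spins d (Fin M)) p) *
          (A i * B j) := by
          simp only [Finset.sum_mul_sum]
          simp only [Finset.sum_mul]
          rw [Finset.sum_comm]
          refine Finset.sum_congr rfl fun i _ => ?_
          rw [Finset.sum_comm]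
          refine Finset.sum_congr rfl fun j _ => Finset.sum_congr rfl fun p _ => ?_
          ring
      _ = _ := by simp [hφ]
  rw [PiLp.inner_apply, ← (Equiv.sumArrowEquivProdArrow (Fin M) (Fin N) (Fin d)).symm.sum_comp,
    Fintype.sum_prod_type, Finset.sum_comm, Finset.mul_sum]
  refine Finset.sum_congr rfl fun s _ => ?_
  rw [← hB, Finset.sum_mul, Finset.mul_sum]
  refine Finset.sum_congr rfl fun p _ => ?_
  have hs : (Equiv.sumArrowEquivProdArrow (Fin M) (Fin N) (Fin d)).symm (p, s) = Sum.elim p s :=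
    rfl
  rw [hs, RCLike.inner_apply, specialState_apply, specialState_apply, ← hsq]
  simp only [map_mul, map_sum, map_inv₀, Complex.conj_ofReal]
  ring

/-- The sites of a predicate, divided according to a second predicate. -/
def sumAndEquiv {ι : Type*} (p q : ι → Prop) [DecidablePred q] :
    {n // p n ∧ q n} ⊕ {n // p n ∧ ¬ q n} ≃ {n // p n} where
  toFun := Sum.elim (fun n => ⟨n.1, n.2.1⟩) (fun n => ⟨n.1, n.2.1⟩)
  invFun n := if h : q n.1 then Sum.inl ⟨n.1, n.2, h⟩ else Sum.inr ⟨n.1, n.2, h⟩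
  left_inv := by
    rintro (⟨n, h1, h2⟩ | ⟨n, h1, h2⟩) <;> simp [h2]
  right_inv := by
    rintro ⟨n, h1⟩
    by_cases h : q n <;> simp [h]

theorem card_and_eq_bitDot {N : ℕ} (x y : Fin N → Bool) :
    Fintype.card {n // x n = true ∧ y n = true} = bitDot x y := by
  rw [Fintype.card_subtype, Finset.card_filter]
  refine Finset.sum_congr rfl fun n _ => ?_
  cases x n <;> cases y n <;> simp

theorem bitDot_add_card {N M : ℕ} (x : BitString N M) (y : Fin N → Bool) :
    bitDot x.1 y + Fintype.card {n // x.1 n = true ∧ ¬ y n = true} = M := by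
  rw [← card_and_eq_bitDot, ← Fintype.card_sum,
    Fintype.card_congr (sumAndEquiv (fun n => x.1 n = true) (fun n => y n = true)),
    card_oneSites]

theorem bitDot_comm {N : ℕ} (x y : Fin N → Bool) : bitDot x y = bitDot y x :=
  Finset.sum_congr rfl fun _ _ => mul_comm _ _

/-- Used with k = x·y and t = M - x·y. The rising factorial is the quotient (k+t+d-1)! / (t+d-1)!.
-/
theorem inv_choose_mul_ascFactorial (k t d : ℕ) (hd : 0 < d) :
    ((k + t + d - 1).choose (k + t) : ℂ)⁻¹ *
      ((t + d).ascFactorial k * t.factorial / (k + t).factorial) =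
      1 / ((t + d - 1).choose (d - 1) : ℂ) := by
  obtain ⟨d, rfl⟩ := Nat.exists_eq_succ_of_ne_zero hd.ne'
  have e1 : k + t + d.succ - 1 = (k + t) + d := by omega
  have e2 : t + d.succ - 1 = t + d := by omega
  rw [e1, e2, Nat.succ_sub_one]
  have h1 : ((k + t + d).choose (k + t) : ℂ) * (k + t).factorial * d.factorial =
      (k + t + d).factorial := by
    have := Nat.add_choose_mul_factorial_mul_factorial (k + t) d
    rw [← Nat.choose_symm_add] at this
    exact_mod_cast this
  have h2 : ((t + d).choose d : ℂ) * t.factorial * d.factorial = (t + d).factorial := by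
    exact_mod_cast Nat.add_choose_mul_factorial_mul_factorial t d
  have h3 : ((t + d).factorial : ℂ) * (t + d.succ).ascFactorial k = (k + t + d).factorial := by
    have := Nat.factorial_mul_ascFactorial (t + d) k
    rw [show t + d + k = k + t + d by ring] at this
    exact_mod_cast this
  have n1 : ((k + t).factorial : ℂ) ≠ 0 := by exact_mod_cast Nat.factorial_ne_zero _
  have n2 : (d.factorial : ℂ) ≠ 0 := by exact_mod_cast Nat.factorial_ne_zero _
  have c1 : ((k + t + d).choose (k + t) : ℂ) ≠ 0 := by
    exact_mod_cast (Nat.choose_pos (by omega)).ne'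
  have c2 : ((t + d).choose d : ℂ) ≠ 0 := by exact_mod_cast (Nat.choose_pos (by omega)).ne'
  field_simp
  apply mul_right_cancel₀ n2
  linear_combination ((t + d.succ).ascFactorial k : ℂ) * h2 + h3 - h1

theorem inner_specialState_eq {d N M : ℕ} (hd : 0 < d) {κ : Type*} [Fintype κ]
    (φ : OrthonormalBasis κ ℂ (symSubspace d (Fin M)))
    (Φ : Spins d (Fin (N - M))) (hΦ : Φ ∈ symSubspace d (Fin (N - M))) (hΦ1 : ‖Φ‖ = 1)
    (x y : BitString N M) :
    inner ℂ (specialState φ Φ x) (specialState φ Φ y) =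
      1 / ((M - bitDot x.1 y.1 + d - 1).choose (d - 1) : ℂ) := by
  -- The output sites fall into four classes: S in both strings, X in x only, Y in y only, R in
  -- neither.
  let p : Fin N → Prop := fun n => x.1 n = true
  let q : Fin N → Prop := fun n => y.1 n = true
  let S := {n // p n ∧ q n}
  let X := {n // p n ∧ ¬ q n}
  let Y := {n // ¬ p n ∧ q n}
  let R := {n // ¬ p n ∧ ¬ q n}
  let swap : ∀ (p q : Fin N → Prop), {n // p n ∧ q n} ≃ {n // q n ∧ p n} := fun p q =>
    Equiv.subtypeEquivRight fun n => and_comm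
  let ex : S ⊕ X ≃ oneSites x.1 := sumAndEquiv p q
  let zx : Y ⊕ R ≃ zeroSites x.1 := sumAndEquiv (fun n => ¬ p n) q
  let ey : S ⊕ Y ≃ oneSites y.1 :=
    (Equiv.sumCongr (swap p q) (swap (fun n => ¬ p n) q)).trans (sumAndEquiv q p)
  let zy : X ⊕ R ≃ zeroSites y.1 :=
    (Equiv.sumCongr (swap p fun n => ¬ q n) (swap (fun n => ¬ p n) fun n => ¬ q n)).trans
      (sumAndEquiv (fun n => ¬ q n) p)
  let g : (S ⊕ X) ⊕ (Y ⊕ R) ≃ Fin N :=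
    (Equiv.sumCongr ex zx).trans (Equiv.sumCompl p)
  have hX : bitDot x.1 y.1 + Fintype.card X = M := bitDot_add_card x y.1
  have hY : bitDot x.1 y.1 + Fintype.card Y = M := by
    rw [Fintype.card_congr (swap (fun n => ¬ p n) q), bitDot_comm]
    exact bitDot_add_card y x.1
  have hS : Fintype.card S = bitDot x.1 y.1 := card_and_eq_bitDot x.1 y.1
  -- Equal weights of x and y give |X| = |Y|.
  have τ : Y ≃ X := Fintype.equivOfCardEq (by omega)
  have key := sum_overlap_placements φ hΦ hΦ1 τ ((enumOnes x).trans ex.symm)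
    ((enumOnes y).trans ey.symm) ((enumZeros x).trans zx.symm) ((enumZeros y).trans zy.symm)
  have hsub : M - bitDot x.1 y.1 = Fintype.card X := by omega
  rw [inner_specialState, hsub, ← inv_choose_mul_ascFactorial (bitDot x.1 y.1) _ d hd, hX, ← hS,
    ← key]
  congr 1
  rw [← (g.symm.arrowCongr (Equiv.refl (Fin d))).symm.sum_comp,
    ← (Equiv.sumArrowEquivProdArrow (S ⊕ X) (Y ⊕ R) (Fin d)).symm.sum_comp,
    Fintype.sum_prod_type,
    ← (Equiv.sumArrowEquivProdArrow S X (Fin d)).symm.sum_comp, Fintype.sum_prod_type]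
  refine Finset.sum_congr rfl fun c _ => Finset.sum_congr rfl fun a _ => ?_
  rw [← (Equiv.sumArrowEquivProdArrow Y R (Fin d)).symm.sum_comp, Fintype.sum_prod_type]
  refine Finset.sum_congr rfl fun b _ => Finset.sum_congr rfl fun r _ => ?_
  let s : Fin N → Fin d := Sum.elim (Sum.elim c a) (Sum.elim b r) ∘ g.symm
  have hs : ∀ j, s (g j) = Sum.elim (Sum.elim c a) (Sum.elim b r) j := fun j => by simp [s]
  have h1 : s ∘ Subtype.val ∘ enumOnes x = Sum.elim c a ∘ ((enumOnes x).trans ex.symm) := by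
    funext j
    obtain ⟨w, hw⟩ := ex.surjective (enumOnes x j)
    simp only [Function.comp, Equiv.trans_apply, ← hw, Equiv.symm_apply_apply]
    rcases w with w | w
    · exact hs (Sum.inl (Sum.inl w))
    · exact hs (Sum.inl (Sum.inr w))
  have h2 : s ∘ Subtype.val ∘ enumOnes y = Sum.elim c b ∘ ((enumOnes y).trans ey.symm) := by
    funext j
    obtain ⟨w, hw⟩ := ey.surjective (enumOnes y j)
    simp only [Function.comp, Equiv.trans_apply, ← hw, Equiv.symm_apply_apply]
    rcases w with w | w
    · exact hs (Sum.inl (Sum.inl w))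
    · exact hs (Sum.inr (Sum.inl w))
  have h3 : s ∘ Subtype.val ∘ enumZeros x = Sum.elim b r ∘ ((enumZeros x).trans zx.symm) := by
    funext j
    obtain ⟨w, hw⟩ := zx.surjective (enumZeros x j)
    simp only [Function.comp, Equiv.trans_apply, ← hw, Equiv.symm_apply_apply]
    rcases w with w | w
    · exact hs (Sum.inr (Sum.inl w))
    · exact hs (Sum.inr (Sum.inr w))
  have h4 : s ∘ Subtype.val ∘ enumZeros y = Sum.elim a r ∘ ((enumZeros y).trans zy.symm) := by
    funext j
    obtain ⟨w, hw⟩ := zy.surjective (enumZeros y j)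
    simp only [Function.comp, Equiv.trans_apply, ← hw, Equiv.symm_apply_apply]
    rcases w with w | w
    · exact hs (Sum.inl (Sum.inr w))
    · exact hs (Sum.inr (Sum.inr w))
  rw [← h1, ← h2, ← h3, ← h4]
  rfl

theorem matrixG_false_apply {d N M : ℕ} (x z : BitString N M) :
    matrixG d M (fun _ : Fin N => false) x z =
      1 / ((M - bitDot x.1 z.1 + d - 1).choose (d - 1) : ℝ) := by
  -- Since x·z ≤ M, the order of the truncated subtractions is immaterial.
  have h : M + d - 1 - bitDot x.1 z.1 = M - bitDot x.1 z.1 + d - 1 := by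
    have := bitDot_add_card x z.1
    omega
  simp [matrixG, bitWeight, h]

theorem mainTheorem12 (d N M : ℕ) (hd : 0 < d) {κ : Type*} [Fintype κ]
    (φ : OrthonormalBasis κ ℂ (symSubspace d (Fin M)))
    (Φ : Spins d (Fin (N - M))) (hΦ : Φ ∈ symSubspace d (Fin (N - M))) (hΦ1 : ‖Φ‖ = 1) :
    (∀ x y : BitString N M,
      inner ℂ (specialState φ Φ x) (specialState φ Φ y) =
        1 / ((M - bitDot x.1 y.1 + d - 1).choose (d - 1) : ℂ)) ∧
    Matrix.gram ℂ (specialState φ Φ : BitString N M → Spins d (Fin M ⊕ Fin N)) =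
      (matrixG d M (fun _ : Fin N => false)).map Complex.ofReal := by
  have h := inner_specialState_eq hd φ Φ hΦ hΦ1
  refine ⟨h, ?_⟩
  ext x z
  rw [Matrix.gram_apply, h, Matrix.map_apply, matrixG_false_apply]
  push_cast
  rfl
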